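/- A topological space $X$ is \emph{$n$-Hausdorff} if its Hausdorff number is at most $n$, where the Hausdorff number of $X$ is the least cardinal $\kappa$ such that for every $A\subseteq X$ with $|A|\ge\kappa$ there are open neighbourhoods $U_a$ of $a$, $a\in A$, with $\bigcap_{a\in A}U_a=\emptyset$. An $n$-Hausdorff space is \emph{$n$-H-closed} if it is closed in every $n$-Hausdorff space in which it is embedded. A space $Y$ is \emph{homogeneous} if for all $x,y\in Y$ there is a homeomorphism $h:Y\to Y$ with $h(x)=y$. Theorem. Let $n\ge 2$ be an integer and let $X$ be an $n$-Hausdorff space. Then $X$ can be embedded in a homogeneous topological space $Y$ that is the union of countably many subspaces, each of which (in the subspace topology) is $n$-H-closed. -/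

import Mathlib

open Cardinal Topology

universe u

/-- The Hausdorff number of `X`: the least cardinal `κ` such that for every subset `A` of `X` with
at least `κ` points there are open neighbourhoods `U a`, `a ∈ A`, with empty intersection. -/
noncomputable def hausdorffNumber (X : Type u) [TopologicalSpace X] : Cardinal.{u} :=
  sInf {κ : Cardinal.{u} | ∀ A : Set X, κ ≤ #A →
    ∃ U : X → Set X, (∀ a ∈ A, IsOpen (U a) ∧ a ∈ U a) ∧ ⋂ a ∈ A, U a = ∅}

/-- `X` is `n`-Hausdorff if its Hausdorff number is at most `n`. -/
def NHausdorff (n : ℕ) (X : Type u) [TopologicalSpace X] : Prop :=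
  hausdorffNumber X ≤ n

theorem nHausdorff_iff (n : ℕ) (X : Type u) [TopologicalSpace X] :
    NHausdorff n X ↔ ∀ A : Set X, (n : Cardinal.{u}) ≤ #A →
      ∃ U : X → Set X, (∀ a ∈ A, IsOpen (U a) ∧ a ∈ U a) ∧ ⋂ a ∈ A, U a = ∅ := by
  constructor
  · intro h A hA
    have hne : {κ : Cardinal.{u} | ∀ A : Set X, κ ≤ #A →
        ∃ U : X → Set X, (∀ a ∈ A, IsOpen (U a) ∧ a ∈ U a) ∧ ⋂ a ∈ A, U a = ∅}.Nonempty :=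
      ⟨Order.succ #X, fun A hA =>
        absurd ((Order.lt_succ #X).trans_le hA) (not_lt.mpr (mk_set_le A))⟩
    exact csInf_mem hne A (h.trans hA)
  · intro h
    exact csInf_le' h

/-- `X` is `n`-H-closed if it is `n`-Hausdorff and it is closed in every `n`-Hausdorff space in
which it is embedded. Letting `Y` range over the universe of `X` loses nothing: if the image of `X`
is not closed in some `Y`, it is not closed in its union with one point of its closure. -/
def NHClosed (n : ℕ) (X : Type u) [TopologicalSpace X] : Prop :=
  NHausdorff n X ∧
    ∀ (Y : Type u) [TopologicalSpace Y], NHausdorff n Y →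
      ∀ f : X → Y, IsEmbedding f → IsClosed (Set.range f)

/-- `X` is homogeneous if its homeomorphisms act transitively on its points. -/
def HomogeneousSpace (X : Type u) [TopologicalSpace X] : Prop :=
  ∀ x y : X, ∃ h : X ≃ₜ X, h x = y

/-!
The space `Y` is built as the union of a sequence of spaces. It is not `n`-Hausdorff in general;
what is kept along the sequence is that each stage is a countable union of `n`-Hausdorff subspaces,
its pieces. Passing to the next stage does two things.

* Every piece is made `n`-H-closed. In an `n`-Hausdorff space an ultrafilter of open sets has fewer
  than `n` limits, and a space in which each of them has exactly `n - 1` limits is `n`-H-closed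
  (`nHClosed_of_encard_limits`). So, as in the Katětov extension, the missing limits are added to
  each piece as new points (`KatetovExtension.nHClosed_completion`). For homeomorphisms to extend,
  this is done to all translates of the pieces under the homeomorphism group. There may be
  uncountably many translates, but the new points form a discrete subspace, so that all of them
  together count as one further piece.
* The space `Z` obtained in this way is embedded, as the set of words of length one, in the free
  product of copies of `ℤ/2` indexed by the points of `Z`. The topology is the finest one for which
  the maps `z ↦ z g` are continuous. Right multiplications are homeomorphisms, so the free product
  is homogeneous, and it depends functorially on `Z`, so homeomorphisms of `Z` extend to it. It is
  again a countable union of `n`-Hausdorff subspaces (`ReducedWord.exists_cover`): the words of a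
  given length fall into lines `{z g}`, which can be separated from each other once the words
  `y z h` with `y` in the closure of `z` are treated apart. For these, points have to be locally
  closed, which is therefore maintained as well.

In the limit every homeomorphism of a stage extends (`exists_homeomorph_limit`), so the limit is
homogeneous, and it is the union of the completed pieces of all stages. A `T₀` space that is
`n`-Hausdorff has locally closed points, because point closures are finite. A general `X` is replaced
by its `T₀` quotient; topologically indistinguishable points, of which there are fewer than `n` in
each class, are separated again by a countable indiscrete factor.
-/

/-! ### Spaces with finitely many points that cannot be separated -/

theorem nHausdorff_iff_finset {n : ℕ} {T : Type u} [TopologicalSpace T] :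
    NHausdorff n T ↔ ∀ A : Finset T, A.card = n →
      ∃ U : T → Set T, (∀ a ∈ A, IsOpen (U a) ∧ a ∈ U a) ∧ ⋂ a ∈ A, U a = ∅ := by
  classical
  rw [nHausdorff_iff]
  constructor
  · intro h A hA
    simpa using h (A : Set T) (by simp [hA])
  · intro h A hA
    obtain ⟨B, hBA, hB⟩ := Cardinal.le_mk_iff_exists_subset.1 hA
    have hfin : B.Finite := by
      rw [← Cardinal.lt_aleph0_iff_set_finite, hB]
      exact Cardinal.natCast_lt_aleph0
    have hcard : hfin.toFinset.card = n := by
      have h1 : #(hfin.toFinset : Set T) = n := by rw [hfin.coe_toFinset, hB]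
      rw [Cardinal.mk_fintype] at h1
      have h2 := Nat.cast_injective h1
      simpa using h2
    obtain ⟨U, hU, hU'⟩ := h _ hcard
    refine ⟨fun a => if a ∈ B then U a else Set.univ, fun a _ => ?_, ?_⟩
    · by_cases ha : a ∈ B
      · simpa [ha] using hU a (by simpa using ha)
      · simp [ha]
    · refine Set.subset_eq_empty (fun x hx => ?_) hU'
      simp only [Set.mem_iInter] at hx ⊢
      intro a ha
      have ha' : a ∈ B := by simpa using ha
      simpa [ha'] using hx a (hBA ha')

theorem NHausdorff.of_injective {n : ℕ} {T T' : Type u} [TopologicalSpace T]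
    [TopologicalSpace T'] (h : NHausdorff n T') {f : T → T'} (hf : Continuous f)
    (hinj : Function.Injective f) : NHausdorff n T := by
  classical
  rw [nHausdorff_iff_finset] at h ⊢
  intro A hA
  obtain ⟨U, hU, hU'⟩ := h (A.image f) (by rw [Finset.card_image_of_injective _ hinj, hA])
  refine ⟨fun a => f ⁻¹' U (f a), fun a ha => ?_, ?_⟩
  · have := hU (f a) (Finset.mem_image_of_mem _ ha)
    exact ⟨this.1.preimage hf, this.2⟩
  · refine Set.eq_empty_iff_forall_notMem.2 fun x hx => ?_
    have : f x ∈ ⋂ a ∈ A.image f, U a := by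
      simpa using hx
    rw [hU'] at this
    exact this

theorem NHausdorff.image {n : ℕ} {T T' : Type u} [TopologicalSpace T] [TopologicalSpace T']
    {S : Set T} (h : NHausdorff n S) {f : T → T'} (hf : IsEmbedding f) :
    NHausdorff n (f '' S) :=
  h.of_injective (hf.homeomorphImage S).symm.continuous (hf.homeomorphImage S).symm.injective

theorem nHausdorff_of_discrete {n : ℕ} (hn : 2 ≤ n) {T : Type u} [TopologicalSpace T]
    [DiscreteTopology T] : NHausdorff n T := by
  rw [nHausdorff_iff_finset]
  intro A hA
  obtain ⟨a, ha, b, hb, hab⟩ := Finset.one_lt_card.1 (by omega : 1 < A.card)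
  refine ⟨fun a => {a}, fun a _ => ⟨isOpen_discrete _, rfl⟩, ?_⟩
  refine Set.eq_empty_iff_forall_notMem.2 fun x hx => ?_
  simp only [Set.mem_iInter, Set.mem_singleton_iff] at hx
  exact hab ((hx a ha).symm.trans (hx b hb))

theorem NHClosed.of_homeomorph {n : ℕ} {T T' : Type u} [TopologicalSpace T]
    [TopologicalSpace T'] (h : NHClosed n T) (e : T ≃ₜ T') : NHClosed n T' := by
  refine ⟨h.1.of_injective e.symm.continuous e.symm.injective, fun Y _ hY f hf => ?_⟩
  have := h.2 Y hY (f ∘ e) (hf.comp e.isEmbedding)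
  rwa [Set.range_comp, e.surjective.range_eq, Set.image_univ] at this

theorem NHClosed.image {n : ℕ} {T T' : Type u} [TopologicalSpace T] [TopologicalSpace T']
    {S : Set T} (h : NHClosed n S) {f : T → T'} (hf : IsEmbedding f) : NHClosed n (f '' S) :=
  h.of_homeomorph (hf.homeomorphImage S)

/-! ### Open ultrafilters -/

/-- A maximal family of open sets that is closed under finite intersections and does not contain
the empty set. Maximality is recorded as: an open set outside the family misses a member. -/
structure OpenUltrafilter (T : Type u) [TopologicalSpace T] where
  /-- The members of the family. -/
  sets : Set (Set T)
  isOpen_of_mem : ∀ V ∈ sets, IsOpen V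
  inter_mem : ∀ V ∈ sets, ∀ W ∈ sets, V ∩ W ∈ sets
  empty_notMem : ∅ ∉ sets
  exists_disjoint : ∀ V, IsOpen V → V ∉ sets → ∃ W ∈ sets, V ∩ W = ∅

namespace OpenUltrafilter

variable {T : Type u} [TopologicalSpace T]

theorem mem_of_subset (p : OpenUltrafilter T) {V W : Set T} (hV : V ∈ p.sets) (hVW : V ⊆ W)
    (hW : IsOpen W) : W ∈ p.sets := by
  by_contra h
  obtain ⟨O, hO, hWO⟩ := p.exists_disjoint W hW h
  have := p.inter_mem V hV O hO
  rw [Set.subset_eq_empty (Set.inter_subset_inter_left O hVW) hWO] at this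
  exact p.empty_notMem this

theorem univ_mem (p : OpenUltrafilter T) : Set.univ ∈ p.sets := by
  by_contra h
  obtain ⟨O, hO, hWO⟩ := p.exists_disjoint _ isOpen_univ h
  rw [Set.univ_inter] at hWO
  exact p.empty_notMem (hWO ▸ hO)

theorem biInter_mem {ι : Type*} (p : OpenUltrafilter T) (A : Finset ι) (U : ι → Set T)
    (h : ∀ a ∈ A, U a ∈ p.sets) : ⋂ a ∈ A, U a ∈ p.sets := by
  classical
  induction A using Finset.induction_on with
  | empty => simpa using p.univ_mem
  | insert a A _ ih =>
    rw [Finset.set_biInter_insert]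
    exact p.inter_mem _ (h a (by simp)) _ (ih fun b hb => h b (by simp [hb]))

theorem eq_of_subset {p q : OpenUltrafilter T} (h : p.sets ⊆ q.sets) : p = q := by
  have : q.sets ⊆ p.sets := by
    intro V hV
    by_contra hVp
    obtain ⟨W, hW, hVW⟩ := p.exists_disjoint V (q.isOpen_of_mem V hV) hVp
    exact q.empty_notMem (hVW ▸ q.inter_mem V hV W (h hW))
  cases p; cases q
  simp only [mk.injEq]
  exact Set.Subset.antisymm h this

/-- A filter base of open sets is contained in an open ultrafilter. -/
theorem exists_superset (B : Set (Set T)) (hopen : ∀ V ∈ B, IsOpen V)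
    (hinter : ∀ V ∈ B, ∀ W ∈ B, V ∩ W ∈ B) (hempty : ∅ ∉ B) (huniv : Set.univ ∈ B) :
    ∃ p : OpenUltrafilter T, B ⊆ p.sets := by
  have hzorn := zorn_subset_nonempty
    {C : Set (Set T) | (∀ V ∈ C, IsOpen V) ∧ (∀ V ∈ C, ∀ W ∈ C, V ∩ W ∈ C) ∧ ∅ ∉ C ∧
      Set.univ ∈ C} ?_ B ⟨hopen, hinter, hempty, huniv⟩
  · obtain ⟨M, hBM, hM⟩ := hzorn
    obtain ⟨h1, h2, h3, h4⟩ := hM.prop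
    refine ⟨⟨M, h1, h2, h3, fun V hV hVM => ?_⟩, hBM⟩
    by_contra hcon
    push Not at hcon
    -- otherwise the open supersets of the sets `V ∩ W`, `W ∈ M`, form a larger family
    have hle := hM.le_of_ge (y := {X | IsOpen X ∧ ∃ W ∈ M, V ∩ W ⊆ X})
      ⟨fun X hX => hX.1, ?_, ?_, isOpen_univ, _, h4, Set.subset_univ _⟩
      (fun X hX => ⟨h1 X hX, X, hX, Set.inter_subset_right⟩)
    · exact hVM (hle ⟨hV, _, h4, Set.inter_subset_left⟩)
    · rintro X ⟨hX, W, hW, hWX⟩ X' ⟨hX', W', hW', hWX'⟩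
      exact ⟨hX.inter hX', _, h2 W hW W' hW', fun x hx =>
        ⟨hWX ⟨hx.1, hx.2.1⟩, hWX' ⟨hx.1, hx.2.2⟩⟩⟩
    · rintro ⟨-, W, hW, hWX⟩
      exact (hcon W hW).ne_empty (Set.subset_eq_empty hWX rfl)
  · intro c hc hchain hne
    refine ⟨⋃₀ c, ⟨?_, ?_, ?_, ?_⟩, fun s hs => Set.subset_sUnion_of_mem hs⟩
    · rintro V ⟨s, hs, hVs⟩
      exact (hc hs).1 V hVs
    · rintro V ⟨s, hs, hVs⟩ W ⟨t, ht, hWt⟩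
      rcases hchain.total hs ht with h | h
      · exact ⟨t, ht, (hc ht).2.1 V (h hVs) W hWt⟩
      · exact ⟨s, hs, (hc hs).2.1 V hVs W (h hWt)⟩
    · rintro ⟨s, hs, h⟩
      exact (hc hs).2.2.1 h
    · obtain ⟨s, hs⟩ := hne
      exact ⟨s, hs, (hc hs).2.2.2⟩

/-- The points all of whose open neighbourhoods belong to the open ultrafilter. -/
def limits (p : OpenUltrafilter T) : Set T :=
  {x | ∀ V, IsOpen V → x ∈ V → V ∈ p.sets}

theorem encard_limits_lt {n : ℕ} (h : NHausdorff n T) (p : OpenUltrafilter T) :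
    p.limits.encard < n := by
  by_contra! hcon
  obtain ⟨A, hA, hAn⟩ := Set.exists_subset_encard_eq hcon
  have hfin : A.Finite := Set.finite_of_encard_eq_coe hAn
  lift A to Finset T using hfin
  rw [Set.encard_coe_eq_coe_finsetCard] at hAn
  obtain ⟨U, hU, hU'⟩ := nHausdorff_iff_finset.1 h A (by exact_mod_cast hAn)
  have := p.biInter_mem A U fun a ha => hA ha _ (hU a ha).1 (hU a ha).2
  rw [hU'] at this
  exact p.empty_notMem this

theorem _root_.nHausdorff_of_encard_limits_lt {n : ℕ}
    (h : ∀ p : OpenUltrafilter T, p.limits.encard < n) : NHausdorff n T := by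
  classical
  rw [nHausdorff_iff_finset]
  intro A hA
  by_contra! hcon
  have hsup := exists_superset (T := T)
    {V | IsOpen V ∧ ∃ U : T → Set T, (∀ a ∈ A, IsOpen (U a) ∧ a ∈ U a) ∧ ⋂ a ∈ A, U a ⊆ V}
    (fun V hV => hV.1) ?_ ?_ ?_
  · obtain ⟨p, hp⟩ := hsup
    refine (h p).not_ge ?_
    rw [← hA, ← Set.encard_coe_eq_coe_finsetCard]
    refine Set.encard_le_encard fun a ha V hV haV => hp ⟨hV, fun b => if b = a then V else
      Set.univ, fun b _ => ?_, ?_⟩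
    · by_cases hb : b = a <;> simp [hb, hV, haV]
    · exact Set.biInter_subset_of_mem (t := fun b => if b = a then V else Set.univ) ha |>.trans
        (by simp)
  · rintro V ⟨hV, U, hU, hUV⟩ W ⟨hW, U', hU', hUW⟩
    refine ⟨hV.inter hW, fun a => U a ∩ U' a, fun a ha =>
      ⟨(hU a ha).1.inter (hU' a ha).1, (hU a ha).2, (hU' a ha).2⟩, fun x hx => ?_⟩
    simp only [Set.mem_iInter, Set.mem_inter_iff] at hx
    exact ⟨hUV (by simpa using fun a ha => (hx a ha).1),
      hUW (by simpa using fun a ha => (hx a ha).2)⟩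
  · rintro ⟨-, U, hU, hUV⟩
    exact (hcon U hU).ne_empty (Set.subset_eq_empty hUV rfl)
  · exact ⟨isOpen_univ, fun _ => Set.univ, fun a _ => ⟨isOpen_univ, trivial⟩, Set.subset_univ _⟩

/-- A space is `n`-H-closed as soon as each of its open ultrafilters has exactly `n - 1` limits: a
point outside the space but in its closure would be an `n`-th limit of some open ultrafilter. -/
theorem _root_.nHClosed_of_encard_limits {n : ℕ}
    (h : ∀ p : OpenUltrafilter T, p.limits.encard + 1 = n) : NHClosed n T := by
  classical
  refine ⟨nHausdorff_of_encard_limits_lt fun p => ?_, fun Y _ hY f hf => ?_⟩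
  · rw [← h p]
    refine ENat.lt_add_one_iff ?_ |>.2 le_rfl
    intro htop
    simpa [htop] using h p
  · refine isClosed_of_closure_subset fun y hy => ?_
    by_contra hyf
    have hsup := exists_superset (T := T) {V | ∃ O, IsOpen O ∧ y ∈ O ∧ f ⁻¹' O = V}
      ?_ ?_ ?_ ⟨_, isOpen_univ, trivial, rfl⟩
    · obtain ⟨p, hp⟩ := hsup
      have hlim := h p
      have hfin : p.limits.Finite := by
        rw [← Set.encard_ne_top_iff]
        intro htop
        simp [htop] at hlim
      have hcard : (insert y (hfin.toFinset.image f)).card = n := by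
        rw [Finset.card_insert_of_notMem, Finset.card_image_of_injective _ hf.injective]
        · rw [hfin.encard_eq_coe_toFinset_card] at hlim
          exact_mod_cast hlim
        · intro hmem
          obtain ⟨x, -, hx⟩ := Finset.mem_image.1 hmem
          exact hyf ⟨x, hx⟩
      obtain ⟨U, hU, hU'⟩ := nHausdorff_iff_finset.1 hY _ hcard
      have hmem := p.biInter_mem (insert y (hfin.toFinset.image f)) (fun a => f ⁻¹' U a) ?_
      · rw [← Set.preimage_iInter₂, hU', Set.preimage_empty] at hmem
        exact p.empty_notMem hmem
      · intro a ha
        have hUa := hU a ha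
        rcases Finset.mem_insert.1 ha with rfl | ha
        · exact hp ⟨_, hUa.1, hUa.2, rfl⟩
        · obtain ⟨x, hx, rfl⟩ := Finset.mem_image.1 ha
          exact (hfin.mem_toFinset.1 hx) _ (hUa.1.preimage hf.continuous) hUa.2
    · rintro V ⟨O, hO, -, rfl⟩
      exact hO.preimage hf.continuous
    · rintro V ⟨O, hO, hyO, rfl⟩ W ⟨O', hO', hyO', rfl⟩
      exact ⟨O ∩ O', hO.inter hO', ⟨hyO, hyO'⟩, rfl⟩
    · rintro ⟨O, hO, hyO, he⟩
      obtain ⟨-, hx, x, rfl⟩ := mem_closure_iff.1 hy O hO hyO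
      have : x ∈ f ⁻¹' O := hx
      rw [he] at this
      exact this

/-- The trace of an open ultrafilter on a dense open subspace. -/
def comap {S : Type u} [TopologicalSpace S] {i : S → T} (hi : IsOpenEmbedding i)
    (hd : DenseRange i) (p : OpenUltrafilter T) : OpenUltrafilter S where
  sets := {W | IsOpen W ∧ i '' W ∈ p.sets}
  isOpen_of_mem W hW := hW.1
  inter_mem V hV W hW := ⟨hV.1.inter hW.1, by
    rw [Set.image_inter hi.injective]
    exact p.inter_mem _ hV.2 _ hW.2⟩
  empty_notMem h := p.empty_notMem (by simpa using h.2)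
  exists_disjoint V hV hVp := by
    have hrange : Set.range i ∈ p.sets := by
      by_contra hr
      obtain ⟨W, hW, hrW⟩ := p.exists_disjoint _ hi.isOpen_range hr
      have hne : W.Nonempty := Set.nonempty_iff_ne_empty.2 fun h => p.empty_notMem (h ▸ hW)
      obtain ⟨x, hx⟩ := hd.inter_open_nonempty W (p.isOpen_of_mem W hW) hne
      have : x ∈ Set.range i ∩ W := ⟨hx.2, hx.1⟩
      rw [hrW] at this
      exact this
    obtain ⟨W, hW, hVW⟩ := p.exists_disjoint (i '' V) (hi.isOpenMap V hV) fun h => hVp ⟨hV, h⟩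
    refine ⟨i ⁻¹' W, ⟨(p.isOpen_of_mem W hW).preimage hi.continuous, ?_⟩, ?_⟩
    · rw [Set.image_preimage_eq_inter_range]
      exact p.inter_mem _ hW _ hrange
    · refine Set.eq_empty_iff_forall_notMem.2 fun x hx => ?_
      have : i x ∈ i '' V ∩ W := ⟨⟨x, hx.1, rfl⟩, hx.2⟩
      rw [hVW] at this
      exact this

end OpenUltrafilter

/-! ### Locally closed points -/

/-- Points are locally closed: every point is open in its closure. This is the separation axiom
`T_D`, strictly between `T₀` and `T₁`. -/
def LocallyClosedPoints (T : Type u) [TopologicalSpace T] : Prop :=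
  ∀ x : T, IsClosed (closure {x} \ {x})

theorem locallyClosedPoints_iff {T : Type u} [TopologicalSpace T] :
    LocallyClosedPoints T ↔
      ∀ x : T, ∃ V, IsOpen V ∧ x ∈ V ∧ ∀ y ∈ V, y ∈ closure {x} → y = x := by
  refine forall_congr' fun x => ⟨fun h => ⟨_, h.isOpen_compl, by simp, fun y hy hyx => ?_⟩, ?_⟩
  · by_contra hne
    exact hy ⟨hyx, hne⟩
  · rintro ⟨V, hV, hxV, h⟩
    have : closure {x} \ {x} = closure {x} ∩ Vᶜ := by
      ext y
      refine ⟨fun hy => ⟨hy.1, fun hyV => hy.2 (h y hyV hy.1)⟩, fun hy => ⟨hy.1, ?_⟩⟩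
      rintro rfl
      exact hy.2 hxV
    rw [this]
    exact isClosed_closure.inter hV.isClosed_compl

theorem NHausdorff.locallyClosedPoints {n : ℕ} {T : Type u} [TopologicalSpace T] [T0Space T]
    (h : NHausdorff n T) : LocallyClosedPoints T := by
  intro x
  -- a point has fewer than `n` points in its closure, as these cannot be separated
  have hfin : (closure {x} : Set T).Finite := by
    by_contra hinf
    obtain ⟨A, hA, hAn⟩ := Set.Infinite.exists_subset_card_eq hinf n
    obtain ⟨U, hU, hU'⟩ := nHausdorff_iff_finset.1 h A hAn
    have : x ∈ ⋂ a ∈ A, U a := by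
      simp only [Set.mem_iInter]
      intro a ha
      obtain ⟨z, hz, hzx⟩ := mem_closure_iff.1 (hA ha) (U a) (hU a ha).1 (hU a ha).2
      rwa [← Set.mem_singleton_iff.1 hzx]
    rw [hU'] at this
    exact this
  have heq : closure {x} \ {x} = ⋃ a ∈ closure {x} \ {x}, closure {a} := by
    refine Set.Subset.antisymm
      (fun a ha => Set.mem_biUnion ha (subset_closure rfl)) (Set.iUnion₂_subset ?_)
    intro a ha b hb
    have hba : b ∈ closure {x} :=
      closure_minimal (Set.singleton_subset_iff.2 ha.1) isClosed_closure hb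
    refine ⟨hba, ?_⟩
    rintro rfl
    exact ha.2 ((specializes_iff_mem_closure.2 hb).antisymm
      (specializes_iff_mem_closure.2 ha.1)).eq
  rw [heq]
  exact (hfin.subset Set.sdiff_subset).isClosed_biUnion fun a _ => isClosed_closure

/-! ### The equivariant Katětov extension -/

/-- The space `Y` together with new points indexed by a self-homeomorphism `g` of `Y`, one of the
pieces `S j`, an open ultrafilter `p` on that piece, and a number below the difference between
`n - 1` and the number of limits of `p`. -/
inductive KatetovExtension (n : ℕ) {Y : Type u} [TopologicalSpace Y] (S : ℕ → Set Y) : Type u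
  | old (y : Y)
  | new (g : Y ≃ₜ Y) (j : ℕ) (p : OpenUltrafilter (S j)) (i : Fin (n - 1 - p.limits.ncard))

namespace KatetovExtension

variable {n : ℕ} {Y : Type u} [TopologicalSpace Y] {S : ℕ → Set Y}

/-- The neighbourhoods of a new point contain the translate by `g` of a member of `p`; `Y` is an
open subspace. -/
instance : TopologicalSpace (KatetovExtension n S) where
  IsOpen V := IsOpen (old ⁻¹' V) ∧
    ∀ g j p i, new g j p i ∈ V → {s : S j | old (g s) ∈ V} ∈ p.sets
  isOpen_univ := ⟨isOpen_univ, fun _ _ p _ _ => p.univ_mem⟩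
  isOpen_inter V W hV hW := ⟨hV.1.inter hW.1, fun g j p i h =>
    p.inter_mem _ (hV.2 g j p i h.1) _ (hW.2 g j p i h.2)⟩
  isOpen_sUnion C hC := by
    have hopen : IsOpen (old ⁻¹' ⋃₀ C : Set Y) := by
      rw [Set.preimage_sUnion]
      exact isOpen_biUnion fun V hV => (hC V hV).1
    refine ⟨hopen, fun g j p i ⟨V, hV, h⟩ => ?_⟩
    refine p.mem_of_subset ((hC V hV).2 g j p i h) (fun s hs => ⟨V, hV, hs⟩) ?_
    exact hopen.preimage (g.continuous.comp continuous_subtype_val)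

theorem isOpen_iff {V : Set (KatetovExtension n S)} : IsOpen V ↔ IsOpen (old ⁻¹' V) ∧
    ∀ g j p i, new g j p i ∈ V → {s : S j | old (g s) ∈ V} ∈ p.sets := Iff.rfl

theorem isOpenEmbedding_old : IsOpenEmbedding (old : Y → KatetovExtension n S) := by
  refine .of_continuous_injective_isOpenMap (continuous_def.2 fun V hV => hV.1)
    (fun x y h => by injection h) fun V hV => isOpen_iff.2 ⟨?_, ?_⟩
  · rwa [Set.preimage_image_eq _ fun x y h => by injection h]
  · rintro g j p i ⟨y, -, hy⟩
    cases hy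

theorem isOpen_insert_new (g : Y ≃ₜ Y) (j : ℕ) (p : OpenUltrafilter (S j))
    (i : Fin (n - 1 - p.limits.ncard)) {O : Set Y} (hO : IsOpen O)
    (hp : {s : S j | g s ∈ O} ∈ p.sets) :
    IsOpen (insert (new g j p i) (old '' O) : Set (KatetovExtension n S)) := by
  refine isOpen_iff.2 ⟨?_, ?_⟩
  · convert hO using 1
    ext y
    simp
  · rintro g' j' p' i' (h | ⟨y, -, hy⟩)
    · cases h
      simpa using hp
    · cases hy

theorem locallyClosedPoints (h : LocallyClosedPoints Y) :
    LocallyClosedPoints (KatetovExtension n S) := by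
  rw [locallyClosedPoints_iff] at h ⊢
  rintro (y | ⟨g, j, p, i⟩)
  · obtain ⟨V, hV, hyV, hVy⟩ := h y
    refine ⟨old '' V, isOpenEmbedding_old.isOpenMap V hV, ⟨y, hyV, rfl⟩, ?_⟩
    rintro _ ⟨z, hz, rfl⟩ hzy
    rw [hVy z hz]
    rw [← specializes_iff_mem_closure] at hzy ⊢
    exact isOpenEmbedding_old.isInducing.specializes_iff.1 hzy
  · refine ⟨Set.univ, isOpen_univ, trivial, fun z _ hz => ?_⟩
    by_contra hne
    have hopen : IsOpen ({new g j p i}ᶜ : Set (KatetovExtension n S)) := by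
      refine isOpen_iff.2 ⟨?_, fun g' j' p' i' _ => ?_⟩
      · convert isOpen_univ
        ext y
        simp
      · convert p'.univ_mem
        ext y
        simp
    obtain ⟨w, hw, hw'⟩ := mem_closure_iff.1 hz _ hopen hne
    exact hw hw'

/-- The new points form a discrete subspace, however many of them there are. -/
theorem nHausdorff_compl_range_old (hn : 2 ≤ n) :
    NHausdorff n ↥(Set.range (old : Y → KatetovExtension n S))ᶜ := by
  have : DiscreteTopology ↥(Set.range (old : Y → KatetovExtension n S))ᶜ := by
    refine discreteTopology_iff_isOpen_singleton.2 ?_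
    rintro ⟨y | ⟨g, j, p, i⟩, hx⟩
    · exact absurd ⟨y, rfl⟩ hx
    · have := isOpen_insert_new g j p i isOpen_univ (by simpa using p.univ_mem)
      convert this.preimage continuous_subtype_val
      ext ⟨z, hz⟩
      have hz' : ∀ y, old y ≠ z := fun y hy => hz ⟨y, hy⟩
      simp [hz']
  exact nHausdorff_of_discrete hn

/-- A homeomorphism of `Y` extends: it acts on the first index of the new points by composition. -/
theorem exists_homeomorph (h : Y ≃ₜ Y) : ∃ h' : KatetovExtension n S ≃ₜ KatetovExtension n S,
    ∀ y, h' (old y) = old (h y) := by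
  let f : (Y ≃ₜ Y) → KatetovExtension n S → KatetovExtension n S := fun h x => match x with
    | old y => old (h y)
    | new g j p i => new (g.trans h) j p i
  have hf : ∀ h, Continuous (f h) := fun h => continuous_def.2 fun V hV =>
    isOpen_iff.2 ⟨hV.1.preimage h.continuous, fun g j p i hx => hV.2 (g.trans h) j p i hx⟩
  have hinv : ∀ h x, f h.symm (f h x) = x := by
    rintro h (y | ⟨g, j, p, i⟩)
    · simp [f]
    · have : (g.trans h).trans h.symm = g := by
        ext y
        simp
      simp only [f, this]
  exact ⟨⟨⟨f h, f h.symm, hinv h, fun x => by simpa using hinv h.symm x⟩, hf h, hf h.symm⟩,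
    fun y => rfl⟩

/-- The piece `S j` together with the new points that are indexed by the identity homeomorphism and
by the open ultrafilters on `S j`. -/
def completion (n : ℕ) (S : ℕ → Set Y) (j : ℕ) : Set (KatetovExtension n S) :=
  old '' S j ∪ {x | ∃ p i, x = new (Homeomorph.refl Y) j p i}

/-- Every open ultrafilter of the completed piece is determined by its trace `p` on `S j`; its limits
are those of `p` and the new points indexed by `p`, which were added to bring the number of limits
up to `n - 1`. -/
theorem nHClosed_completion {j : ℕ} (hS : NHausdorff n (S j)) :
    NHClosed n (completion n S j) := by
  let ι : S j → completion n S j := fun s => ⟨old s, Or.inl ⟨s, s.2, rfl⟩⟩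
  have hι : IsOpenEmbedding ι := by
    have hemb : IsEmbedding ι := by
      refine IsEmbedding.of_comp ?_ continuous_subtype_val ?_
      · exact Continuous.subtype_mk
          (isOpenEmbedding_old.continuous.comp continuous_subtype_val) _
      · exact isOpenEmbedding_old.isEmbedding.comp IsEmbedding.subtypeVal
    refine ⟨hemb, ?_⟩
    convert (isOpenEmbedding_old (n := n) (S := S)).isOpen_range.preimage
      (continuous_subtype_val : Continuous ((↑) : completion n S j → _))
    ext ⟨x, hx⟩
    constructor
    · rintro ⟨s, hs⟩
      exact ⟨s, congrArg Subtype.val hs⟩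
    · rintro ⟨y, rfl⟩
      rcases hx with ⟨y', hy', he⟩ | ⟨p, i, hx⟩
      · injection he with he
        exact ⟨⟨y, he ▸ hy'⟩, rfl⟩
      · cases hx
  let ν : ∀ p : OpenUltrafilter (S j), Fin (n - 1 - p.limits.ncard) → completion n S j :=
    fun p i => ⟨new (Homeomorph.refl Y) j p i, Or.inr ⟨p, i, rfl⟩⟩
  have hcases : ∀ x, (∃ s, x = ι s) ∨ ∃ p i, x = ν p i := by
    rintro ⟨x, ⟨s, hs, rfl⟩ | ⟨p, i, rfl⟩⟩
    · exact Or.inl ⟨⟨s, hs⟩, rfl⟩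
    · exact Or.inr ⟨p, i, rfl⟩
  have hιν : ∀ s p i, ι s ≠ ν p i := fun s p i h => by
    have := congrArg Subtype.val h
    cases this
  -- traces of neighbourhoods of the new points
  have htrace : ∀ p i V, IsOpen V → ν p i ∈ V → ι ⁻¹' V ∈ p.sets := by
    rintro p i _ ⟨V, hV, rfl⟩ h
    exact hV.2 _ _ _ _ h
  have hnhd : ∀ p i, ∀ W ∈ p.sets, IsOpen (insert (ν p i) (ι '' W)) := by
    intro p i W hW
    obtain ⟨O, hO, rfl⟩ := p.isOpen_of_mem W hW
    convert (isOpen_insert_new (n := n) (Homeomorph.refl Y) j p i hO hW).preimage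
      (continuous_subtype_val : Continuous ((↑) : completion n S j → _))
    ext x
    simp only [Set.mem_insert_iff, Set.mem_preimage]
    refine or_congr Subtype.ext_iff ?_
    constructor
    · rintro ⟨s, hs, rfl⟩
      exact ⟨s, hs, rfl⟩
    · rintro ⟨y, hy, hyx⟩
      rcases hcases x with ⟨s, rfl⟩ | ⟨p', i', rfl⟩
      · injection hyx with hyx
        exact ⟨s, by simpa [← hyx] using hy, rfl⟩
      · cases hyx
  have hdense : DenseRange ι := by
    refine dense_iff_inter_open.2 fun V hV => ?_
    rintro ⟨x, hx⟩
    rcases hcases x with ⟨s, rfl⟩ | ⟨p, i, rfl⟩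
    · exact ⟨_, hx, s, rfl⟩
    · have hmem := htrace p i V hV hx
      have hne : (ι ⁻¹' V).Nonempty :=
        Set.nonempty_iff_ne_empty.2 fun h => p.empty_notMem (h ▸ hmem)
      obtain ⟨s, hs⟩ := hne
      exact ⟨ι s, hs, s, rfl⟩
  refine nHClosed_of_encard_limits fun q => ?_
  set p := q.comap hι hdense with hp
  have hpq : ∀ W, W ∈ p.sets → ι '' W ∈ q.sets := fun W hW => hW.2
  have hlim : q.limits = ι '' p.limits ∪ Set.range (ν p) := by
    ext x
    rcases hcases x with ⟨s, rfl⟩ | ⟨p', i, rfl⟩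
    · have hr : ι s ∉ Set.range (ν p) := by
        rintro ⟨i, hi⟩
        exact hιν _ _ _ hi.symm
      simp only [Set.mem_union, hr, or_false, hι.injective.mem_set_image]
      refine ⟨fun h V hV hs => ⟨hV, h _ (hι.isOpenMap V hV) ⟨s, hs, rfl⟩⟩, fun h V hV hs => ?_⟩
      exact q.mem_of_subset (hpq _ (h _ (hV.preimage hι.continuous) hs))
        (Set.image_preimage_subset _ _) hV
    · have hr : ν p' i ∉ ι '' p.limits := by
        rintro ⟨s, -, hs⟩
        exact hιν _ _ _ hs
      simp only [Set.mem_union, hr, false_or]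
      constructor
      · intro h
        have : p' = p := by
          refine OpenUltrafilter.eq_of_subset fun W hW => ⟨p'.isOpen_of_mem W hW, ?_⟩
          have h1 := h _ (hnhd p' i W hW) (Set.mem_insert _ _)
          have h2 := q.inter_mem _ h1 _ (hpq _ p.univ_mem)
          refine q.mem_of_subset h2 ?_ (hι.isOpenMap W (p'.isOpen_of_mem W hW))
          rintro _ ⟨hx | hx, s, -, rfl⟩
          · exact absurd hx (hιν _ _ _)
          · exact hx
        subst this
        exact ⟨i, rfl⟩
      · rintro ⟨i', hi'⟩ V hV hx
        rw [← hi'] at hx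
        exact q.mem_of_subset (hpq _ (htrace p i' V hV hx)) (Set.image_preimage_subset _ _) hV
  have hlt := p.encard_limits_lt hS
  have hfin : p.limits.Finite := Set.finite_of_encard_le_coe hlt.le
  have hdisj : Disjoint (ι '' p.limits) (Set.range (ν p)) := by
    rw [Set.disjoint_left]
    rintro _ ⟨s, -, rfl⟩ ⟨i, hi⟩
    exact hιν _ _ _ hi.symm
  have hν : Function.Injective (ν p) := fun a b h => by
    have := congrArg Subtype.val h
    injection this with _ _ _ h
  rw [hlim, Set.encard_union_eq hdisj, hι.injective.encard_image, ← Set.image_univ,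
    hν.encard_image, Set.encard_univ, ENat.card_eq_coe_fintype_card, Fintype.card_fin,
    ← hfin.cast_ncard_eq]
  rw [← hfin.cast_ncard_eq] at hlt
  have : p.limits.ncard < n := by exact_mod_cast hlt
  norm_cast
  omega

end KatetovExtension

/-! ### The space of reduced words -/

/-- Words in the letters `Y` without equal consecutive letters. These are the elements of the free
product of copies of `ℤ/2` indexed by `Y`; the head of the list is the left end of the word. -/
@[ext]
structure ReducedWord (Y : Type u) : Type u where
  /-- The letters of the word. -/
  letters : List Y
  isChain : letters.IsChain (· ≠ ·)

namespace ReducedWord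

open Classical in
/-- Left multiplication by a letter `y`: the letter is put in front of the word, or cancelled
against the first letter of the word if that is `y` as well. -/
noncomputable def toggle {Y : Type u} (y : Y) (w : ReducedWord Y) : ReducedWord Y :=
  if h : w.letters.head? = some y then ⟨w.letters.tail, w.isChain.tail⟩
  else ⟨y :: w.letters, List.isChain_cons.2 ⟨fun z hz => by
    rintro rfl
    exact h hz, w.isChain⟩⟩

/-- The empty word. -/
def nil (Y : Type u) : ReducedWord Y := ⟨[], List.isChain_nil⟩

/-- The word with the single letter `y`. -/
def single {Y : Type u} (y : Y) : ReducedWord Y := ⟨[y], List.isChain_singleton y⟩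

variable {Y Z : Type u}

theorem letters_eq_cons_toggle {y : Y} {w : ReducedWord Y} (h : w.letters.head? = some y) :
    w.letters = y :: (toggle y w).letters := by
  rw [toggle, dif_pos h]
  exact (List.cons_head?_tail h).symm

theorem letters_toggle {y : Y} {w : ReducedWord Y} (h : w.letters.head? ≠ some y) :
    (toggle y w).letters = y :: w.letters := by
  rw [toggle, dif_neg h]

theorem head?_toggle {y : Y} {w : ReducedWord Y} (h : w.letters.head? = some y) :
    (toggle y w).letters.head? ≠ some y := by
  intro h'
  have := w.isChain
  rw [letters_eq_cons_toggle h, letters_eq_cons_toggle h'] at this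
  exact (List.isChain_cons_cons.1 this).1 rfl

theorem toggle_toggle (y : Y) (w : ReducedWord Y) : toggle y (toggle y w) = w := by
  apply ReducedWord.ext
  by_cases h : w.letters.head? = some y
  · rw [letters_toggle (head?_toggle h), ← letters_eq_cons_toggle h]
  · have h' : (toggle y w).letters.head? = some y := by
      rw [letters_toggle h]
      rfl
    have := letters_eq_cons_toggle h'
    rw [letters_toggle h] at this
    exact (List.cons.inj this).2.symm

theorem eq_toggle {y : Y} {w v : ReducedWord Y} (h : w.letters = y :: v.letters) :
    w = toggle y v := by
  have h' := letters_eq_cons_toggle (y := y) (w := w) (by rw [h]; rfl)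
  rw [h] at h'
  rw [ReducedWord.ext (List.cons.inj h').2, toggle_toggle]

theorem toggle_nil (y : Y) : toggle y (nil Y) = single y := (eq_toggle rfl).symm

/-- A property that holds for the empty word and is preserved by the left multiplications holds for
every word. -/
theorem toggle_induction {P : ReducedWord Y → Prop} (hnil : P (nil Y))
    (h : ∀ y w, P w → P (toggle y w)) (w : ReducedWord Y) : P w := by
  obtain ⟨l, hl⟩ := w
  induction l with
  | nil => exact hnil
  | cons y l ih =>
    rw [eq_toggle (w := ⟨y :: l, hl⟩) (y := y) (v := ⟨l, hl.tail⟩) rfl]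
    exact h _ _ (ih hl.tail)

/-- Multiplication of words, `mul s r = s r`: the letters of `s` act on `r` one after the other,
from the last one to the first one. -/
noncomputable def mul (s r : ReducedWord Y) : ReducedWord Y :=
  s.letters.foldr toggle r

theorem mul_toggle (y : Y) (s r : ReducedWord Y) : mul (toggle y s) r = toggle y (mul s r) := by
  by_cases h : s.letters.head? = some y
  · rw [mul, mul, letters_eq_cons_toggle h, List.foldr_cons, toggle_toggle]
  · rw [mul, letters_toggle h]
    rfl

theorem nil_mul (r : ReducedWord Y) : mul (nil Y) r = r := rfl

theorem mul_nil (r : ReducedWord Y) : mul r (nil Y) = r := by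
  induction r using toggle_induction with
  | hnil => rfl
  | h y w ih => rw [mul_toggle, ih]

theorem mul_assoc (s r t : ReducedWord Y) : mul (mul s r) t = mul s (mul r t) := by
  induction s using toggle_induction with
  | hnil => rfl
  | h y w ih => rw [mul_toggle, mul_toggle, mul_toggle, ih]

theorem exists_mul_eq_nil (r : ReducedWord Y) : ∃ s, mul s r = nil Y ∧ mul r s = nil Y := by
  induction r using toggle_induction with
  | hnil => exact ⟨nil Y, rfl, rfl⟩
  | h y w ih =>
    obtain ⟨s, hs, hs'⟩ := ih
    refine ⟨mul s (toggle y (nil Y)), ?_, ?_⟩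
    · rw [mul_assoc, mul_toggle, nil_mul, toggle_toggle, hs]
    · rw [mul_toggle, ← mul_assoc, hs', nil_mul, toggle_toggle]

/-- The map on words induced by an injective map of letters. -/
def map (f : Y → Z) (hf : Function.Injective f) (w : ReducedWord Y) : ReducedWord Z :=
  ⟨w.letters.map f, by
    rw [List.isChain_map]
    exact w.isChain.imp fun _ _ h => hf.ne h⟩

theorem map_toggle (f : Y → Z) (hf : Function.Injective f) (y : Y) (w : ReducedWord Y) :
    map f hf (toggle y w) = toggle (f y) (map f hf w) := by
  by_cases h : w.letters.head? = some y
  · rw [eq_toggle (w := map f hf w) (v := map f hf (toggle y w)) (y := f y), toggle_toggle]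
    exact congrArg (List.map f) (letters_eq_cons_toggle h)
  · exact eq_toggle (congrArg (List.map f) (letters_toggle h))

theorem suffix_unique {c c' : Y} {g g' l : List Y} (h : c :: g <:+ l) (h' : c' :: g' <:+ l)
    (hlen : g'.length = g.length) : g' = g ∧ c' = c := by
  have := (List.suffix_of_suffix_length_le h' h (by simp [hlen])).eq_of_length (by simp [hlen])
  injection this with h1 h2
  exact ⟨h2, h1⟩

section Topology

variable [TopologicalSpace Y] [TopologicalSpace Z]

/-- The finest topology for which the maps `y ↦ y g` from `Y` to the space of words are continuous,
for all words `g`. A neighbourhood of `v = z (z v)` contains `y (z v)` for all `y` close to `z`. -/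
instance : TopologicalSpace (ReducedWord Y) where
  IsOpen V := ∀ v ∈ V, ∀ z, ∀ᶠ y in 𝓝 z, toggle y (toggle z v) ∈ V
  isOpen_univ := fun _ _ _ => Filter.univ_mem
  isOpen_inter _ _ hV hW := fun v hv z => (hV v hv.1 z).and (hW v hv.2 z)
  isOpen_sUnion _ hC := fun v ⟨V, hV, hv⟩ z =>
    (hC V hV v hv z).mono fun _ hy => ⟨V, hV, hy⟩

theorem isOpen_iff {V : Set (ReducedWord Y)} :
    IsOpen V ↔ ∀ v ∈ V, ∀ z, ∀ᶠ y in 𝓝 z, toggle y (toggle z v) ∈ V := Iff.rfl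

theorem continuous_mul_right (r : ReducedWord Y) : Continuous fun s => mul s r := by
  refine continuous_def.2 fun V hV => isOpen_iff.2 fun v hv z => ?_
  filter_upwards [isOpen_iff.1 hV _ hv z] with y hy
  simpa [mul_toggle] using hy

/-- Right multiplications commute with left multiplications, so they are homeomorphisms, and they
act transitively. -/
theorem homogeneousSpace : HomogeneousSpace (ReducedWord Y) := by
  intro r s
  obtain ⟨r', hr, hr'⟩ := exists_mul_eq_nil r
  obtain ⟨s', hs, hs'⟩ := exists_mul_eq_nil s
  refine ⟨⟨⟨fun w => mul w (mul r' s), fun w => mul w (mul s' r), fun w => ?_, fun w => ?_⟩,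
    continuous_mul_right _, continuous_mul_right _⟩, ?_⟩
  · change mul (mul w (mul r' s)) (mul s' r) = w
    rw [mul_assoc, mul_assoc r', ← mul_assoc s, hs', nil_mul, hr, mul_nil]
  · change mul (mul w (mul s' r)) (mul r' s) = w
    rw [mul_assoc, mul_assoc s', ← mul_assoc r, hr', nil_mul, hs, mul_nil]
  · change mul r (mul r' s) = s
    rw [← mul_assoc, hr', nil_mul]

theorem continuous_map (f : Y → Z) (hf : Function.Injective f) (hc : Continuous f) :
    Continuous (map f hf) := by
  refine continuous_def.2 fun V hV => isOpen_iff.2 fun v hv z => ?_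
  filter_upwards [hc.continuousAt.eventually (isOpen_iff.1 hV _ hv (f z))] with y hy
  simpa [map_toggle] using hy

theorem exists_homeomorph (h : Y ≃ₜ Y) :
    ∃ h' : ReducedWord Y ≃ₜ ReducedWord Y, ∀ y, h' (single y) = single (h y) :=
  ⟨{ toFun := map h h.injective
     invFun := map h.symm h.symm.injective
     left_inv := fun w => ReducedWord.ext (by simp [map])
     right_inv := fun w => ReducedWord.ext (by simp [map])
     continuous_toFun := continuous_map _ _ h.continuous
     continuous_invFun := continuous_map _ _ h.symm.continuous }, fun _ => rfl⟩

/-- The main source of open sets of words. Membership of a word in the set below depends only on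
the parity of its length and on its last `m + 1` letters: these are to satisfy `Q`, or to satisfy
`E` if the word is shorter. -/
theorem isOpen_setOf_suffix (m : ℕ) (E : Prop) (Q : List Y → Y → Prop)
    (hQ : ∀ g, g.length = m → IsOpen {c | Q g c})
    (hE : E → ∀ z h, h.length + 1 = m → ∀ᶠ y in 𝓝 z, y ≠ z → Q (z :: h) y)
    (hE' : ¬E → ∀ z h, ¬Q (z :: h) z) :
    IsOpen {w : ReducedWord Y | w.letters.length % 2 = (m + 1) % 2 ∧ (w.letters.length ≤ m → E) ∧
      ∀ c g, g.length = m → c :: g <:+ w.letters → Q g c} := by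
  rintro v ⟨h1, h2, h3⟩ z
  by_cases hz : v.letters.head? = some z
  · -- the first letter of `v` is replaced by another one
    have hv := letters_eq_cons_toggle hz
    generalize toggle z v = u at hv ⊢
    rw [hv] at h1 h2 h3
    simp only [List.length_cons] at h1 h2
    have hcase : ∀ᶠ y in 𝓝 z, u.letters.length = m → Q u.letters y := by
      by_cases hm : u.letters.length = m
      · filter_upwards [(hQ _ hm).mem_nhds (h3 z _ hm List.suffix_rfl)] with y hy _ using hy
      · exact Filter.Eventually.of_forall fun y h => absurd h hm
    filter_upwards [hcase] with y hy
    by_cases hyu : u.letters.head? = some y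
    · have hu := letters_eq_cons_toggle hyu
      generalize toggle y u = t at hu ⊢
      rw [hu] at h1 h2 h3 hy
      simp only [List.length_cons] at h1 h2 hy
      refine ⟨by omega, fun h => ?_, fun c g hg hs =>
        h3 c g hg (hs.trans ((List.suffix_cons _ _).trans (List.suffix_cons _ _)))⟩
      by_cases hm : t.letters.length + 1 = m
      · by_contra hE''
        exact hE' hE'' _ _ (hy hm)
      · exact h2 (by omega)
    · have ht := letters_toggle hyu
      generalize toggle y u = t at ht ⊢
      refine ⟨?_, ?_, fun c g hg hs => ?_⟩
      · rw [ht]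
        exact h1
      · rw [ht]
        exact h2
      · rw [ht] at hs
        rcases List.suffix_cons_iff.1 hs with heq | hs
        · injection heq with hc heq
          subst hc heq
          exact hy hg
        · exact h3 c g hg (hs.trans (List.suffix_cons _ _))
  · -- two letters are put in front of `v`
    have hcase : ∀ᶠ y in 𝓝 z, v.letters.length + 1 = m → y ≠ z → Q (z :: v.letters) y := by
      by_cases hm : v.letters.length + 1 = m
      · filter_upwards [hE (h2 (by omega)) z _ hm] with y hy _ using hy
      · exact Filter.Eventually.of_forall fun y h => absurd h hm
    filter_upwards [hcase] with y hy
    by_cases hyz : y = z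
    · subst hyz
      rw [toggle_toggle]
      exact ⟨h1, h2, h3⟩
    · have ht := letters_toggle (y := y) (w := toggle z v)
        (by rw [letters_toggle hz]; simpa using Ne.symm hyz)
      rw [letters_toggle hz] at ht
      generalize toggle y (toggle z v) = t at ht ⊢
      refine ⟨?_, ?_, fun c g hg hs => ?_⟩
      · rw [ht]
        simp only [List.length_cons]
        omega
      · rw [ht]
        simp only [List.length_cons]
        exact fun h => h2 (by omega)
      · rw [ht] at hs
        rcases List.suffix_cons_iff.1 hs with heq | hs
        · injection heq with hc heq
          subst hc heq
          exact hy (by simpa using hg) hyz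
        · rcases List.suffix_cons_iff.1 hs with heq | hs
          · injection heq with hc heq
            subst hc heq
            omega
          · exact h3 c g hg hs

/-- The basic neighbourhoods of the words `c g`: if `U` does not contain the first letter of `g`, the
words that end in `c g` with `c ∈ U`, and are longer by an even number of letters, form an open
set. -/
theorem isOpen_line {g : List Y} {U : Set Y} (hU : IsOpen U) (hg : ∀ z ∈ g.head?, z ∉ U) :
    IsOpen {w : ReducedWord Y | w.letters.length % 2 = (g.length + 1) % 2 ∧
      (w.letters.length ≤ g.length → False) ∧
      ∀ c g', g'.length = g.length → c :: g' <:+ w.letters → g' = g ∧ c ∈ U} := by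
  refine isOpen_setOf_suffix g.length False (fun g' c => g' = g ∧ c ∈ U) (fun g' _ => ?_)
    (fun h => h.elim) ?_
  · by_cases h : g' = g <;> simp [h, hU]
  · rintro - z h ⟨rfl, hz⟩
    exact hg z rfl hz

theorem isEmbedding_single : IsEmbedding (single : Y → ReducedWord Y) := by
  refine ⟨isInducing_iff_nhds.2 fun y => le_antisymm ?_ ?_, fun x y h => ?_⟩
  · refine Filter.map_le_iff_le_comap.1 fun V hV => ?_
    obtain ⟨W, hWV, hW, hyW⟩ := mem_nhds_iff.1 hV
    have := isOpen_iff.1 hW _ hyW y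
    rw [← toggle_nil, toggle_toggle] at this
    refine Filter.mem_map.2 (this.mono fun z hz => ?_)
    rw [toggle_nil] at hz
    exact hWV hz
  · intro U hU
    obtain ⟨O, hOU, hO, hyO⟩ := mem_nhds_iff.1 hU
    refine ⟨_, (isOpen_line (g := []) hO (by simp)).mem_nhds ⟨rfl, by simp [single], ?_⟩, ?_⟩
    · intro c g hg hs
      obtain ⟨rfl, rfl⟩ := suffix_unique (l := [y]) List.suffix_rfl hs hg
      exact ⟨rfl, hyO⟩
    · rintro z ⟨-, -, hz⟩
      exact hOU (hz z [] rfl List.suffix_rfl).2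
  · have := congrArg letters h
    simpa [single] using this

end Topology

end ReducedWord

theorem LocallyClosedPoints.eventually {Y : Type u} [TopologicalSpace Y]
    (h : LocallyClosedPoints Y) (z : Y) : ∀ᶠ y in 𝓝 z, y ≠ z → y ∉ closure {z} := by
  filter_upwards [(h z).isOpen_compl.mem_nhds (by simp)] with y hy hyz hyc
  exact hy ⟨hyc, hyz⟩

namespace ReducedWord

variable {n : ℕ} {Y : Type u} [TopologicalSpace Y]

theorem isOpen_notMem_closure_head (g : List Y) :
    IsOpen {c : Y | ∀ z ∈ g.head?, c ∉ closure {z}} := by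
  cases g with
  | nil => simp
  | cons z g =>
    convert (isClosed_closure (s := {z})).isOpen_compl using 1
    ext c
    simp

theorem locallyClosedPoints (hY : LocallyClosedPoints Y) :
    LocallyClosedPoints (ReducedWord Y) := by
  rw [locallyClosedPoints_iff]
  -- by homogeneity, only the empty word has to be considered
  suffices h : ∃ V, IsOpen V ∧ nil Y ∈ V ∧ ∀ y ∈ V, y ∈ closure {nil Y} → y = nil Y by
    intro w
    obtain ⟨V, hV, hV1, hV2⟩ := h
    obtain ⟨e, he⟩ := homogeneousSpace w (nil Y)
    refine ⟨e ⁻¹' V, hV.preimage e.continuous, by rwa [Set.mem_preimage, he], fun y hy hyw => ?_⟩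
    refine e.injective ((hV2 _ hy ?_).trans he.symm)
    rw [← specializes_iff_mem_closure] at hyw ⊢
    rw [← he]
    exact hyw.map e.continuous
  refine ⟨_, isOpen_setOf_suffix 1 True (fun g c => ∀ z ∈ g.head?, c ∉ closure {z})
    (fun g _ => isOpen_notMem_closure_head g) ?_ (fun h => (h trivial).elim),
    ⟨by simp [nil], fun _ => trivial, fun c g _ hs => ?_⟩, ?_⟩
  · intro _ z h _
    simpa using hY.eventually z
  · have := hs.length_le
    simp [nil] at this
  · rintro ⟨l, hl⟩ ⟨hl1, -, hl2⟩ hy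
    simp only at hl1 hl2
    by_contra hne
    have hlen : 2 ≤ l.length := by
      rcases l with _ | ⟨a, _ | ⟨b, l⟩⟩
      · exact absurd rfl hne
      · simp at hl1
      · simp
    have hs : l.drop (l.length - 2) <:+ l := List.drop_suffix _ _
    have hs' : (l.drop (l.length - 2)).length = 2 := by
      rw [List.length_drop]
      omega
    obtain ⟨c, z, hcz⟩ := List.length_eq_two.1 hs'
    rw [hcz] at hs
    have hc : c ∉ closure {z} := hl2 c [z] rfl hs z rfl
    -- the words that end in `c' z` with `c'` outside the closure of `z` form an open set
    obtain ⟨v, hv, hv'⟩ := mem_closure_iff.1 hy _ (isOpen_line (g := [z])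
      (isClosed_closure (s := {z})).isOpen_compl (fun x hx h => h (by
        obtain rfl : z = x := by simpa using hx
        exact subset_closure rfl)))
      ⟨hl1, fun h => by simp only [List.length_singleton] at h; omega, fun c' g' hg' hs'' => by
        obtain ⟨rfl, rfl⟩ := suffix_unique hs hs'' hg'
        exact ⟨rfl, hc⟩⟩
    rw [Set.mem_singleton_iff.1 hv'] at hv
    exact hv.2.1 (by simp [nil])

/-- A set of words is `n`-Hausdorff if neighbourhoods in it of a word `c g` are given by the
neighbourhoods of the letter `c` in an `n`-Hausdorff space. -/
theorem nHausdorff_of_nhds (hn : 2 ≤ n) {S : Set Y} (hS : NHausdorff n S)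
    {P : Set (ReducedWord Y)}
    (hP : ∀ w ∈ P, ∃ c g, w.letters = c :: g ∧ c ∈ S ∧ ∀ U, IsOpen U → c ∈ U →
      ∃ V, IsOpen V ∧ w ∈ V ∧ ∀ v ∈ V, v ∈ P → ∃ c' ∈ U, v.letters = c' :: g) :
    NHausdorff n P := by
  classical
  rw [nHausdorff_iff_finset]
  intro A hA
  obtain ⟨a₀, -⟩ : A.Nonempty := Finset.card_pos.1 (by omega)
  have : Nonempty Y := ⟨(hP a₀ a₀.2).choose⟩
  choose! c g hcg hcS hV using hP
  choose! V hVo hwV hVP using hV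
  by_cases htail : ∃ a ∈ A, ∃ b ∈ A, g a ≠ g b
  · obtain ⟨a, ha, b, hb, hab⟩ := htail
    refine ⟨fun w => (↑) ⁻¹' V w Set.univ, fun w _ => ⟨?_, ?_⟩, ?_⟩
    · exact (hVo w w.2 _ isOpen_univ trivial).preimage continuous_subtype_val
    · exact hwV w w.2 _ isOpen_univ trivial
    · refine Set.eq_empty_iff_forall_notMem.2 fun x hx => ?_
      simp only [Set.mem_iInter] at hx
      obtain ⟨c₁, -, h₁⟩ := hVP a a.2 _ isOpen_univ trivial x (hx a ha) x.2
      obtain ⟨c₂, -, h₂⟩ := hVP b b.2 _ isOpen_univ trivial x (hx b hb) x.2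
      exact hab (List.cons.inj (h₁.symm.trans h₂)).2
  · push Not at htail
    let hd : P → S := fun w => ⟨c w, hcS w w.2⟩
    have hinj : Set.InjOn hd A := fun a ha b hb h => by
      have hc : c a = c b := congrArg Subtype.val h
      apply Subtype.ext
      apply ReducedWord.ext
      rw [hcg a a.2, hcg b b.2, hc, htail a ha b hb]
    obtain ⟨U, hU, hU'⟩ := nHausdorff_iff_finset.1 hS (A.image hd)
      (by rw [Finset.card_image_of_injOn hinj, hA])
    have hO : ∀ s, ∃ O : Set Y, s ∈ A.image hd → IsOpen O ∧ (↑) ⁻¹' O = U s := fun s => by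
      by_cases hs : s ∈ A.image hd
      · obtain ⟨O, hO⟩ := (hU s hs).1
        exact ⟨O, fun _ => hO⟩
      · exact ⟨∅, fun h => absurd h hs⟩
    choose O hO using hO
    have hcO : ∀ a ∈ A, IsOpen (O (hd a)) ∧ c a ∈ O (hd a) := fun a ha => by
      have hmem := Finset.mem_image_of_mem hd ha
      refine ⟨(hO _ hmem).1, ?_⟩
      have : hd a ∈ U (hd a) := (hU _ hmem).2
      rwa [← (hO _ hmem).2] at this
    refine ⟨fun w => (↑) ⁻¹' V w (O (hd w)), fun w hw => ⟨?_, ?_⟩, ?_⟩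
    · exact (hVo w w.2 _ (hcO w hw).1 (hcO w hw).2).preimage continuous_subtype_val
    · exact hwV w w.2 _ (hcO w hw).1 (hcO w hw).2
    · refine Set.eq_empty_iff_forall_notMem.2 fun x hx => ?_
      simp only [Set.mem_iInter] at hx
      have hxU : hd x ∈ ⋂ s ∈ A.image hd, U s := by
        simp only [Set.mem_iInter]
        intro s hs
        obtain ⟨a, ha, rfl⟩ := Finset.mem_image.1 hs
        rw [← (hO _ hs).2]
        obtain ⟨c', hc', h'⟩ := hVP a a.2 _ (hcO a ha).1 (hcO a ha).2 x (hx a ha) x.2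
        rw [hcg x x.2] at h'
        rw [← (List.cons.inj h').1] at hc'
        exact hc'
      rw [hU'] at hxU
      exact hxU

/-- Words of length `m + 2` whose first letter lies in `S` and in the closure of the second one. -/
def closeWords (S : Set Y) (m : ℕ) : Set (ReducedWord Y) :=
  {w | ∃ c z h, w.letters = c :: z :: h ∧ h.length = m ∧ c ∈ S ∧ c ∈ closure {z}}

/-- Words of length `m + 1` whose first letter lies in `S` and not in the closure of the second
letter, if there is one. -/
def farWords (S : Set Y) (m : ℕ) : Set (ReducedWord Y) :=
  {w | ∃ c g, w.letters = c :: g ∧ g.length = m ∧ c ∈ S ∧ ∀ z ∈ g.head?, c ∉ closure {z}}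

theorem nHausdorff_farWords (hn : 2 ≤ n) {S : Set Y} (hS : NHausdorff n S) (m : ℕ) :
    NHausdorff n (farWords S m) := by
  refine nHausdorff_of_nhds hn hS ?_
  rintro w ⟨c, g, hw, rfl, hc, hcz⟩
  refine ⟨c, g, hw, hc, fun U hU hcU => ⟨_, isOpen_line (g := g)
    (hU.inter (isOpen_notMem_closure_head g)) ?_, ⟨?_, ?_, ?_⟩, ?_⟩⟩
  · exact fun z hz h => h.2 z hz (subset_closure rfl)
  · simp [hw]
  · simp [hw]
  · intro c' g' hg' hs
    rw [hw] at hs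
    obtain ⟨rfl, rfl⟩ := suffix_unique List.suffix_rfl hs hg'
    exact ⟨rfl, hcU, hcz⟩
  · rintro v ⟨-, -, hv⟩ ⟨c', g', hv', hg', -⟩
    obtain ⟨rfl, hc'⟩ := hv c' g' hg' (by rw [hv'])
    exact ⟨c', hc'.1, hv'⟩

/-- A neighbourhood of `c z h`, with `c` in the closure of `z`, contains `h` and hence words `y x h`
for all letters `x`. As points are locally closed, it can be chosen to contain these only for `y`
outside of the closure of `x`, unless `x = z`. -/
theorem nHausdorff_closeWords (hn : 2 ≤ n) (hY : LocallyClosedPoints Y) {S : Set Y}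
    (hS : NHausdorff n S) (m : ℕ) : NHausdorff n (closeWords S m) := by
  refine nHausdorff_of_nhds hn hS ?_
  rintro w ⟨c, z, h, hw, rfl, hc, hcz⟩
  refine ⟨c, z :: h, hw, hc, fun U hU hcU => ?_⟩
  have hzU : z ∈ U := by
    obtain ⟨z', hz', hz⟩ := mem_closure_iff.1 hcz U hU hcU
    rwa [← Set.mem_singleton_iff.1 hz]
  refine ⟨_, isOpen_setOf_suffix (h.length + 1) True (fun g' c' => (g' = z :: h → c' ∈ U) ∧
    (g' ≠ z :: h → ∀ x ∈ g'.head?, c' ∉ closure {x})) (fun g' _ => ?_) ?_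
    (fun h => (h trivial).elim), ⟨?_, fun _ => trivial, ?_⟩, ?_⟩
  · by_cases hg : g' = z :: h
    · simpa [hg] using hU
    · simpa [hg] using isOpen_notMem_closure_head g'
  · intro _ x g' _
    by_cases hg : x :: g' = z :: h
    · obtain ⟨rfl, rfl⟩ := List.cons.inj hg
      filter_upwards [hU.mem_nhds hzU] with y hy _ using ⟨fun _ => hy, fun hne => absurd rfl hne⟩
    · filter_upwards [hY.eventually x] with y hy hyx
      exact ⟨fun h => absurd h hg, fun _ => by simpa using hy hyx⟩
  · simp [hw]
  · intro c' g' hg' hs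
    rw [hw] at hs
    obtain ⟨rfl, rfl⟩ := suffix_unique List.suffix_rfl hs hg'
    exact ⟨fun _ => hcU, fun h => absurd rfl h⟩
  · rintro v ⟨-, -, hv⟩ ⟨c', z', h', hv', hh', -, hc'⟩
    obtain ⟨h1, h2⟩ := hv c' (z' :: h') (by simp [hh']) (by rw [hv'])
    by_cases hg : z' :: h' = z :: h
    · exact ⟨c', h1 hg, by rw [hv', hg]⟩
    · exact absurd hc' (h2 hg z' rfl)

/-- Countable covers by `n`-Hausdorff subspaces pass to the space of words: the words are sorted by
their length, by the piece that contains the first letter, and by whether the first letter lies in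
the closure of the second one. -/
theorem exists_cover (hn : 2 ≤ n) (hY : LocallyClosedPoints Y) {S : ℕ → Set Y}
    (hS : ∀ j, NHausdorff n (S j)) (hcov : ⋃ j, S j = Set.univ) :
    ∃ S' : ℕ → Set (ReducedWord Y), (∀ j, NHausdorff n (S' j)) ∧ ⋃ j, S' j = Set.univ := by
  let P : Option ((ℕ × ℕ) ⊕ (ℕ × ℕ)) → Set (ReducedWord Y) := fun k => match k with
    | none => {nil Y}
    | some (Sum.inl (j, m)) => closeWords (S j) m
    | some (Sum.inr (j, m)) => farWords (S j) m
  obtain ⟨e, he⟩ := exists_surjective_nat (Option ((ℕ × ℕ) ⊕ (ℕ × ℕ)))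
  have hP : ∀ k, NHausdorff n (P k) := by
    rintro (_ | ⟨j, m⟩ | ⟨j, m⟩)
    · have : DiscreteTopology ({nil Y} : Set (ReducedWord Y)) := inferInstance
      exact nHausdorff_of_discrete hn
    · exact nHausdorff_closeWords hn hY (hS j) m
    · exact nHausdorff_farWords hn (hS j) m
  refine ⟨fun j => P (e j), fun j => hP _, ?_⟩
  · rw [he.iUnion_comp P]
    refine Set.eq_univ_of_forall fun w => Set.mem_iUnion.2 ?_
    have hmem : ∀ c : Y, ∃ j, c ∈ S j := fun c => Set.mem_iUnion.1 (hcov ▸ Set.mem_univ c)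
    rcases hw : w.letters with _ | ⟨c, g⟩
    · exact ⟨none, ReducedWord.ext hw⟩
    · obtain ⟨j, hj⟩ := hmem c
      by_cases hfar : ∀ z ∈ g.head?, c ∉ closure {z}
      · exact ⟨some (Sum.inr (j, g.length)), c, g, hw, rfl, hj, hfar⟩
      · push Not at hfar
        obtain ⟨z, hz, hcz⟩ := hfar
        obtain ⟨h, rfl⟩ : ∃ h, g = z :: h := by
          cases g with
          | nil => simp at hz
          | cons x h => exact ⟨h, by simpa using hz⟩
        exact ⟨some (Sum.inl (j, h.length)), c, z, h, hw, rfl, hj, hcz⟩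

end ReducedWord

/-! ### Homogeneous spaces as unions of sequences of spaces -/

/-- A space with locally closed points and a distinguished countable cover by `n`-Hausdorff
subspaces. -/
structure CoveredSpace (n : ℕ) where
  /-- The underlying type. -/
  carrier : Type u
  /-- The topology. -/
  [top : TopologicalSpace carrier]
  /-- The members of the cover. -/
  cover : ℕ → Set carrier
  locallyClosedPoints : LocallyClosedPoints carrier
  nHausdorff_cover : ∀ j, NHausdorff n (cover j)
  iUnion_cover : ⋃ j, cover j = Set.univ

attribute [instance] CoveredSpace.top

/-- One stage of the construction: the pieces are completed, and the space of words over the result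
makes all points alike. -/
theorem CoveredSpace.exists_extension {n : ℕ} (hn : 2 ≤ n) (A : CoveredSpace.{u} n) :
    ∃ (B : CoveredSpace.{u} n) (f : A.carrier → B.carrier), IsEmbedding f ∧
      HomogeneousSpace B.carrier ∧
      (∀ h : A.carrier ≃ₜ A.carrier, ∃ h' : B.carrier ≃ₜ B.carrier, ∀ y, h' (f y) = f (h y)) ∧
      ∀ j, ∃ K : Set B.carrier, NHClosed n K ∧ f '' A.cover j ⊆ K := by
  let E := KatetovExtension n A.cover
  have hE : LocallyClosedPoints E := KatetovExtension.locallyClosedPoints A.locallyClosedPoints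
  let S : ℕ → Set E := fun j => match j with
    | 0 => (Set.range KatetovExtension.old)ᶜ
    | j + 1 => KatetovExtension.old '' A.cover j
  have hS : ∀ j, NHausdorff n (S j) := by
    rintro (_ | j)
    · exact KatetovExtension.nHausdorff_compl_range_old hn
    · exact (A.nHausdorff_cover j).image KatetovExtension.isOpenEmbedding_old.isEmbedding
  have hScov : ⋃ j, S j = Set.univ := by
    refine Set.eq_univ_of_forall fun x => Set.mem_iUnion.2 ?_
    by_cases hx : x ∈ Set.range KatetovExtension.old
    · obtain ⟨y, rfl⟩ := hx
      obtain ⟨j, hj⟩ := Set.mem_iUnion.1 (A.iUnion_cover ▸ Set.mem_univ y)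
      exact ⟨j + 1, y, hj, rfl⟩
    · exact ⟨0, hx⟩
  obtain ⟨S', hS', hS'cov⟩ := ReducedWord.exists_cover hn hE hS hScov
  refine ⟨⟨ReducedWord E, S', ReducedWord.locallyClosedPoints hE, hS', hS'cov⟩,
    ReducedWord.single ∘ KatetovExtension.old, ReducedWord.isEmbedding_single.comp
      KatetovExtension.isOpenEmbedding_old.isEmbedding, ReducedWord.homogeneousSpace,
    fun h => ?_, fun j => ?_⟩
  · obtain ⟨h₁, hh₁⟩ := KatetovExtension.exists_homeomorph (n := n) (S := A.cover) h
    obtain ⟨h₂, hh₂⟩ := ReducedWord.exists_homeomorph h₁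
    exact ⟨h₂, fun y => (hh₂ _).trans (congrArg ReducedWord.single (hh₁ y))⟩
  · refine ⟨_, (KatetovExtension.nHClosed_completion (A.nHausdorff_cover j)).image
      ReducedWord.isEmbedding_single, ?_⟩
    rw [Set.image_comp]
    exact Set.image_mono Set.subset_union_left

section Limit

variable {F : ℕ → Type u} (e : ∀ k, F k → F (k + 1))

/-- A sequence of injective maps has a direct limit. -/
theorem exists_directLimit (he : ∀ k, Function.Injective (e k)) :
    ∃ (L : Type u) (i : ∀ k, F k → L), (∀ k, Function.Injective (i k)) ∧
      (∀ k x, i (k + 1) (e k x) = i k x) ∧ ∀ z, ∃ k x, i k x = z := by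
  classical
  -- points are represented at the stage where they appear first
  let new : ∀ k, F k → Prop := fun k => match k with
    | 0 => fun _ => True
    | k + 1 => fun x => x ∉ Set.range (e k)
  let L := {z : Σ k, F k // new z.1 z.2}
  let i : ∀ k, F k → L := fun k => Nat.rec (motive := fun k => F k → L)
    (fun x => ⟨⟨0, x⟩, trivial⟩)
    (fun k ik x => if h : ∃ y, e k y = x then ik h.choose else ⟨⟨k + 1, x⟩, h⟩) k
  have hcompat : ∀ k x, i (k + 1) (e k x) = i k x := fun k x => by
    have h : ∃ y, e k y = e k x := ⟨x, rfl⟩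
    change (if h : ∃ y, e k y = e k x then i k h.choose else _) = i k x
    rw [dif_pos h, he k h.choose_spec]
  have hnew : ∀ k x (h : new k x), i k x = ⟨⟨k, x⟩, h⟩ := by
    rintro (_ | k) x h
    · rfl
    · exact dif_neg h
  have hstage : ∀ k x, (i k x).1.1 ≤ k := by
    intro k
    induction k with
    | zero => exact fun x => le_rfl
    | succ k ih =>
      intro x
      by_cases h : ∃ y, e k y = x
      · obtain ⟨y, rfl⟩ := h
        rw [hcompat]
        exact (ih y).trans (Nat.le_succ k)
      · exact (congrArg (fun z : L => z.1.1) (hnew (k + 1) x h)).le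
  refine ⟨L, i, fun k => ?_, hcompat, fun ⟨⟨k, x⟩, h⟩ => ⟨k, x, hnew k x h⟩⟩
  induction k with
  | zero =>
    intro x y hxy
    have h0 : (⟨0, x⟩ : Σ k, F k) = ⟨0, y⟩ := congrArg Subtype.val hxy
    simpa using h0
  | succ k ih =>
    have hne : ∀ x y, (∃ w, e k w = x) → (¬∃ w, e k w = y) → i (k + 1) x ≠ i (k + 1) y := by
      rintro _ y ⟨w, rfl⟩ hy heq
      rw [hcompat, hnew (k + 1) y hy] at heq
      have := hstage k w
      rw [heq] at this
      exact absurd this (by simp)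
    intro x y hxy
    by_cases hx : ∃ w, e k w = x <;> by_cases hy : ∃ w, e k w = y
    · obtain ⟨v, rfl⟩ := hx
      obtain ⟨w, rfl⟩ := hy
      rw [hcompat, hcompat] at hxy
      rw [ih hxy]
    · exact absurd hxy (hne x y hx hy)
    · exact absurd hxy.symm (hne y x hy hx)
    · rw [hnew (k + 1) x hx, hnew (k + 1) y hy] at hxy
      have := congrArg Subtype.val hxy
      simpa using this

variable {e} {L : Type u} {i : ∀ k, F k → L}

theorem exists_ge_of_limit (hcompat : ∀ k x, i (k + 1) (e k x) = i k x)
    (hsurj : ∀ z, ∃ k x, i k x = z) (m : ℕ) (z : L) : ∃ k ≥ m, ∃ x, i k x = z := by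
  induction m with
  | zero =>
    obtain ⟨k, x, hx⟩ := hsurj z
    exact ⟨k, Nat.zero_le k, x, hx⟩
  | succ m ih =>
    obtain ⟨k, hk, x, hx⟩ := ih
    exact ⟨k + 1, Nat.succ_le_succ hk, e k x, (hcompat k x).trans hx⟩

theorem exists_eq_of_le (hcompat : ∀ k x, i (k + 1) (e k x) = i k x) {k l : ℕ} (hkl : k ≤ l)
    (x : F k) : ∃ y, i l y = i k x := by
  induction l, hkl using Nat.le_induction with
  | base => exact ⟨x, rfl⟩
  | succ l _ ih =>
    obtain ⟨y, hy⟩ := ih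
    exact ⟨e l y, (hcompat l y).trans hy⟩

/-- A sequence of maps that is compatible from stage `m` on induces a map on the limit. -/
theorem exists_map_of_limit (hinj : ∀ k, Function.Injective (i k))
    (hcompat : ∀ k x, i (k + 1) (e k x) = i k x) (hsurj : ∀ z, ∃ k x, i k x = z) (m : ℕ)
    (G : ∀ k, F k → F k) (hG : ∀ k ≥ m, ∀ x, G (k + 1) (e k x) = e k (G k x)) :
    ∃ φ : L → L, ∀ k ≥ m, ∀ x, φ (i k x) = i k (G k x) := by
  have hmono : ∀ k ≥ m, ∀ l ≥ k, ∀ x, ∃ y, i l y = i k x ∧ i l (G l y) = i k (G k x) := by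
    intro k hk l hl x
    induction l, hl using Nat.le_induction with
    | base => exact ⟨x, rfl, rfl⟩
    | succ l hl ih =>
      obtain ⟨y, hy, hy'⟩ := ih
      refine ⟨e l y, (hcompat l y).trans hy, ?_⟩
      rw [hG l (hk.trans hl), hcompat, hy']
  have hwd : ∀ k ≥ m, ∀ l ≥ k, ∀ x y, i k x = i l y → i k (G k x) = i l (G l y) := by
    intro k hk l hl x y hxy
    obtain ⟨y', hy', hy''⟩ := hmono k hk l hl x
    rw [← hy'', hinj l (hy'.trans hxy)]
  choose κ hκ ξ hξ using exists_ge_of_limit hcompat hsurj m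
  refine ⟨fun z => i (κ z) (G (κ z) (ξ z)), fun k hk x => ?_⟩
  rcases le_total k (κ (i k x)) with h | h
  · exact (hwd k hk _ h x _ (hξ _).symm).symm
  · exact hwd _ (hκ _) k h _ x (hξ _)

variable [∀ k, TopologicalSpace (F k)]

/-- Stage `k` of the sequence is a subspace of the limit: an open set of stage `k` extends to open
sets of all later stages, step by step, and the union of these is open in the limit. -/
theorem isEmbedding_limit [TopologicalSpace L] (he : ∀ k, IsEmbedding (e k))
    (hinj : ∀ k, Function.Injective (i k)) (hcompat : ∀ k x, i (k + 1) (e k x) = i k x)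
    (hopen : ∀ V : Set L, IsOpen V ↔ ∀ k, IsOpen (i k ⁻¹' V)) (m : ℕ) : IsEmbedding (i m) := by
  refine ⟨⟨le_antisymm (continuous_iff_le_induced.1 (continuous_def.2 fun V hV =>
    (hopen V).1 hV m)) ?_⟩, hinj m⟩
  intro U hU
  -- the trace of the open set on each stage, chosen from stage `m` on
  have hext : ∀ k (O : Set (F k)), ∃ O' : Set (F (k + 1)), IsOpen O → IsOpen O' ∧
      e k ⁻¹' O' = O := fun k O => by
    by_cases hO : IsOpen O
    · obtain ⟨O', h1, h2⟩ := (he k).isInducing.isOpen_iff.1 hO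
      exact ⟨O', fun _ => ⟨h1, h2⟩⟩
    · exact ⟨∅, fun h => absurd h hO⟩
  choose ext hext using hext
  let W : ∀ l, Set (F (m + l)) := fun l => Nat.rec (motive := fun l => Set (F (m + l))) U
    (fun l O => ext (m + l) O) l
  have hW : ∀ l, IsOpen (W l) := by
    intro l
    induction l with
    | zero => exact hU
    | succ l ih => exact (hext _ _ ih).1
  have hWe : ∀ l x, e (m + l) x ∈ W (l + 1) ↔ x ∈ W l := fun l x => by
    rw [← Set.mem_preimage]
    exact iff_of_eq (congrArg (x ∈ ·) (hext _ _ (hW l)).2)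
  let V : Set L := ⋃ l, i (m + l) '' W l
  have hmono : ∀ l d, ∀ x ∈ W l, i (m + l) x ∈ i (m + (l + d)) '' W (l + d) := by
    intro l d x hx
    induction d with
    | zero => exact ⟨x, hx, rfl⟩
    | succ d ih =>
      obtain ⟨y, hy, hyx⟩ := ih
      exact ⟨e _ y, (hWe _ y).2 hy, (hcompat _ y).trans hyx⟩
  have hback : ∀ l d, ∀ x, i (m + l) x ∈ i (m + (l + d)) '' W (l + d) → x ∈ W l := by
    intro l d x hx
    induction d with
    | zero =>
      obtain ⟨y, hy, hyx⟩ := hx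
      rwa [← hinj _ hyx]
    | succ d ih =>
      obtain ⟨y, hy, hyx⟩ := hx
      refine ih ?_
      obtain ⟨x', hx'⟩ := exists_eq_of_le hcompat (by omega : m + l ≤ m + (l + d)) x
      refine ⟨x', (hWe _ x').1 ?_, hx'⟩
      rwa [← hinj (m + (l + d) + 1) (hyx.trans (hx'.symm.trans (hcompat _ x').symm))]
  have hVW : ∀ l x, i (m + l) x ∈ V ↔ x ∈ W l := by
    refine fun l x => ⟨fun h => ?_, fun h => Set.mem_iUnion.2 ⟨l, x, h, rfl⟩⟩
    obtain ⟨l', y, hy, hyx⟩ := Set.mem_iUnion.1 h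
    have h1 := hmono l' l y hy
    rw [hyx, Nat.add_comm l' l] at h1
    exact hback l l' x h1
  have hVo : IsOpen V := by
    refine (hopen V).2 fun k => ?_
    have hge : ∀ k ≥ m, IsOpen (i k ⁻¹' V) := fun k hk => by
      obtain ⟨l, rfl⟩ := Nat.exists_eq_add_of_le hk
      convert hW l using 1
      ext x
      exact hVW l x
    have hdown : ∀ d k, k + d ≥ m → IsOpen (i k ⁻¹' V) := by
      intro d
      induction d with
      | zero => exact hge
      | succ d ih =>
        intro k hk
        have := (ih (k + 1) (by omega)).preimage (he k).continuous
        convert this using 1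
        ext x
        simp [hcompat]
    exact hdown m k (by omega)
  exact ⟨V, hVo, by ext x; exact hVW 0 x⟩

/-- A homeomorphism of stage `m` extends to the limit if at every stage all homeomorphisms extend to
the next stage. -/
theorem exists_homeomorph_limit [TopologicalSpace L]
    (hinj : ∀ k, Function.Injective (i k)) (hcompat : ∀ k x, i (k + 1) (e k x) = i k x)
    (hsurj : ∀ z, ∃ k x, i k x = z) (hopen : ∀ V : Set L, IsOpen V ↔ ∀ k, IsOpen (i k ⁻¹' V))
    (hcont : ∀ k, Continuous (e k))
    (hext : ∀ k (h : F k ≃ₜ F k), ∃ h' : F (k + 1) ≃ₜ F (k + 1), ∀ x, h' (e k x) = e k (h x))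
    (m : ℕ) (h : F m ≃ₜ F m) : ∃ H : L ≃ₜ L, ∀ x, H (i m x) = i m (h x) := by
  classical
  choose ext hext using hext
  -- the extensions of `h` to the stages from `m` on; the earlier stages do not matter
  let G : ∀ k, F k ≃ₜ F k := fun k => Nat.rec (motive := fun k => F k ≃ₜ F k)
    (if hm : m = 0 then hm.rec (motive := fun k _ => F k ≃ₜ F k) h else Homeomorph.refl _)
    (fun k g => if hm : m = k + 1 then hm.rec (motive := fun k _ => F k ≃ₜ F k) h else ext k g) k
  have hGm : G m = h := by
    cases m with
    | zero => rfl
    | succ m => exact dif_pos (c := m + 1 = m + 1) rfl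
  have hGs : ∀ k ≥ m, G (k + 1) = ext k (G k) := fun k hk => dif_neg (by omega)
  have hG : ∀ k ≥ m, ∀ x, G (k + 1) (e k x) = e k (G k x) := fun k hk x => by
    rw [hGs k hk, hext]
  have hG' : ∀ k ≥ m, ∀ x, (G (k + 1)).symm (e k x) = e k ((G k).symm x) := fun k hk x => by
    rw [Homeomorph.symm_apply_eq, hG k hk, Homeomorph.apply_symm_apply]
  obtain ⟨φ, hφ⟩ := exists_map_of_limit hinj hcompat hsurj m (fun k => G k) hG
  obtain ⟨ψ, hψ⟩ := exists_map_of_limit hinj hcompat hsurj m (fun k => (G k).symm) hG'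
  have hge := exists_ge_of_limit hcompat hsurj m
  have hc : ∀ (g : ∀ k, F k ≃ₜ F k) (χ : L → L), (∀ k ≥ m, ∀ x, χ (i k x) = i k (g k x)) →
      Continuous χ := by
    intro g χ hχ
    refine continuous_def.2 fun V hV => (hopen _).2 fun k => ?_
    have hstage : ∀ k ≥ m, IsOpen (i k ⁻¹' (χ ⁻¹' V)) := fun k hk => by
      convert ((hopen V).1 hV k).preimage (g k).continuous using 1
      ext x
      simp [hχ k hk]
    have hdown : ∀ d k, k + d ≥ m → IsOpen (i k ⁻¹' (χ ⁻¹' V)) := by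
      intro d
      induction d with
      | zero => exact hstage
      | succ d ih =>
        intro k hk
        convert (ih (k + 1) (by omega)).preimage (hcont k) using 1
        ext x
        simp [hcompat]
    exact hdown m k (by omega)
  refine ⟨⟨⟨φ, ψ, fun z => ?_, fun z => ?_⟩, hc G φ hφ, hc (fun k => (G k).symm) ψ hψ⟩,
    fun x => ?_⟩
  · obtain ⟨k, hk, x, rfl⟩ := hge z
    rw [hφ k hk, hψ k hk, Homeomorph.symm_apply_apply]
  · obtain ⟨k, hk, x, rfl⟩ := hge z
    rw [hψ k hk, hφ k hk, Homeomorph.apply_symm_apply]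
  · exact (hφ m le_rfl x).trans (by rw [hGm])

end Limit

/-- A space with a countable cover by `n`-Hausdorff subspaces need not be `n`-Hausdorff, but it embeds
in a homogeneous space that is a countable union of `n`-H-closed subspaces, namely the limit of the
sequence of its iterated extensions. -/
theorem CoveredSpace.exists_homogeneous {n : ℕ} (hn : 2 ≤ n) (A : CoveredSpace.{u} n) :
    ∃ (L : Type u) (_ : TopologicalSpace L) (f : A.carrier → L) (S : ℕ → Set L),
      IsEmbedding f ∧ HomogeneousSpace L ∧ (∀ j, NHClosed n (S j)) ∧ ⋃ j, S j = Set.univ := by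
  choose next f hf hhom hext hK using fun B : CoveredSpace.{u} n => B.exists_extension hn
  choose K hK hfK using hK
  let A' : ℕ → CoveredSpace.{u} n := fun k =>
    Nat.rec (motive := fun _ => CoveredSpace.{u} n) A (fun _ B => next B) k
  let e : ∀ k, (A' k).carrier → (A' (k + 1)).carrier := fun k => f (A' k)
  have he : ∀ k, IsEmbedding (e k) := fun k => hf (A' k)
  obtain ⟨L, i, hinj, hcompat, hsurj⟩ := exists_directLimit e fun k => (he k).injective
  let top : TopologicalSpace L := ⨆ k, .coinduced (i k) (A' k).top
  have hopen : ∀ V : Set L, IsOpen V ↔ ∀ k, IsOpen (i k ⁻¹' V) := fun V => by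
    simp only [top, isOpen_iSup_iff, isOpen_coinduced]
  have hi : ∀ k, IsEmbedding (i k) :=
    isEmbedding_limit he hinj hcompat hopen
  let P : ℕ × ℕ → Set L := fun q => i (q.1 + 1) '' K (A' q.1) q.2
  obtain ⟨r, hr⟩ := exists_surjective_nat (ℕ × ℕ)
  refine ⟨L, top, i 0, fun j => P (r j), hi 0, ?_,
    fun j => (hK _ _).image (hi _), ?_⟩
  · intro x y
    obtain ⟨k, -, x, rfl⟩ := exists_ge_of_limit hcompat hsurj 0 x
    obtain ⟨l, hl, y, rfl⟩ := exists_ge_of_limit hcompat hsurj (k + 1) y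
    obtain ⟨l, rfl⟩ := Nat.exists_eq_add_of_le' (Nat.le_of_add_left_le hl)
    obtain ⟨x', hx'⟩ := exists_eq_of_le hcompat (Nat.le_of_succ_le hl) x
    obtain ⟨g, hg⟩ := hhom (A' l) x' y
    obtain ⟨H, hH⟩ := exists_homeomorph_limit hinj hcompat hsurj hopen
      (fun k => (he k).continuous) (fun k => hext (A' k)) (l + 1) g
    exact ⟨H, by rw [← hx', hH, hg]⟩
  · rw [hr.iUnion_comp P]
    refine Set.eq_univ_of_forall fun z => Set.mem_iUnion.2 ?_
    obtain ⟨k, x, rfl⟩ := hsurj z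
    obtain ⟨j, hj⟩ := Set.mem_iUnion.1 ((A' k).iUnion_cover ▸ Set.mem_univ x)
    exact ⟨(k, j), e k x, hfK (A' k) j ⟨x, hj, rfl⟩, hcompat k x⟩

/-! ### Topologically indistinguishable points -/

theorem NHausdorff.separationQuotient {n : ℕ} {X : Type u} [TopologicalSpace X]
    (hX : NHausdorff n X) : NHausdorff n (SeparationQuotient X) := by
  let s := Function.surjInv (SeparationQuotient.surjective_mk (X := X))
  have hs : SeparationQuotient.mk ∘ s = id :=
    funext (Function.surjInv_eq SeparationQuotient.surjective_mk)
  refine hX.of_injective (f := s) ?_ (Function.injective_surjInv _)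
  rw [SeparationQuotient.isInducing_mk.continuous_iff, hs]
  exact continuous_id

/-- In an `n`-Hausdorff space, every class of topologically indistinguishable points has fewer than
`n` elements. Hence there is a colouring of the points that separates them. -/
theorem NHausdorff.exists_nat_injective {n : ℕ} {X : Type u} [TopologicalSpace X]
    (hX : NHausdorff n X) :
    ∃ c : X → ℕ, Function.Injective fun x => (SeparationQuotient.mk x, c x) := by
  have hfin : ∀ q : SeparationQuotient X, (SeparationQuotient.mk ⁻¹' {q}).Finite := fun q => by
    by_contra hinf
    obtain ⟨A, hA, hAn⟩ := Set.Infinite.exists_subset_card_eq hinf n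
    obtain ⟨U, hU, hU'⟩ := nHausdorff_iff_finset.1 hX A hAn
    obtain ⟨x, rfl⟩ := SeparationQuotient.surjective_mk q
    have : x ∈ ⋂ a ∈ A, U a := by
      simp only [Set.mem_iInter]
      intro a ha
      exact ((SeparationQuotient.mk_eq_mk.1 (hA ha)).mem_open_iff (hU a ha).1).1 (hU a ha).2
    rw [hU'] at this
    exact this
  choose c hc using fun q => Set.countable_iff_exists_injOn.1 (hfin q).countable
  refine ⟨fun x => c (SeparationQuotient.mk x) x, fun x y hxy => ?_⟩
  obtain ⟨h1, h2⟩ := Prod.mk.inj hxy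
  simp only [← h1] at h2
  exact hc _ rfl h1.symm h2

theorem mainTheorem6 (n : ℕ) (hn : 2 ≤ n) (X : Type u) [TopologicalSpace X]
    (hX : NHausdorff n X) :
    ∃ (Y : Type u) (_ : TopologicalSpace Y) (f : X → Y) (S : ℕ → Set Y),
      IsEmbedding f ∧ HomogeneousSpace Y ∧
        (∀ m, NHClosed n (S m)) ∧ ⋃ m, S m = Set.univ := by
  have hQ := hX.separationQuotient
  let A : CoveredSpace.{u} n := ⟨SeparationQuotient X, fun _ => Set.univ,
    hQ.locallyClosedPoints, fun _ => hQ.of_injective continuous_subtype_val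
      Subtype.val_injective, Set.iUnion_const _⟩
  obtain ⟨L, _, f, S, hf, hhom, hS, hcov⟩ := A.exists_homogeneous hn
  obtain ⟨c, hc⟩ := hX.exists_nat_injective
  -- the second factor is indiscrete
  let top : TopologicalSpace (L × ℕ) := .induced Prod.fst inferInstance
  have hfst : IsInducing (Prod.fst : L × ℕ → L) := ⟨rfl⟩
  have hi : ∀ m : ℕ, IsEmbedding fun z : L => (z, m) := fun m =>
    ⟨⟨by rw [hfst.eq_induced, induced_compose]; exact induced_id.symm⟩, fun x y h =>
      congrArg Prod.fst h⟩
  refine ⟨L × ℕ, top, fun x => (f (SeparationQuotient.mk x), c x),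
    fun k => (fun z => (z, k.unpair.2)) '' S k.unpair.1, ⟨⟨?_⟩, fun x y hxy => ?_⟩, ?_,
    fun k => (hS _).image (hi _), ?_⟩
  · rw [hfst.eq_induced, induced_compose]
    exact (hf.isInducing.comp SeparationQuotient.isInducing_mk).eq_induced
  · obtain ⟨h1, h2⟩ := Prod.mk.inj hxy
    exact hc (Prod.ext (hf.injective h1) h2)
  · rintro ⟨x, k⟩ ⟨y, l⟩
    obtain ⟨h, hxy⟩ := hhom x y
    refine ⟨⟨h.toEquiv.prodCongr (Equiv.swap k l), ?_, ?_⟩, ?_⟩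
    · exact hfst.continuous_iff.2 (h.continuous.comp hfst.continuous)
    · exact hfst.continuous_iff.2 (h.symm.continuous.comp hfst.continuous)
    · exact Prod.ext hxy (Equiv.swap_apply_left k l)
  · refine Set.eq_univ_of_forall fun ⟨z, m⟩ => Set.mem_iUnion.2 ?_
    obtain ⟨j, hj⟩ := Set.mem_iUnion.1 (hcov ▸ Set.mem_univ z)
    exact ⟨Nat.pair j m, by simpa [Nat.unpair_pair] using hj⟩
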